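/- Let $H_0,H_1,H_2,\dots$ be the classical Hermite polynomials, $H_0=1$, $H_1=2x$, $xH_n=\tfrac12H_{n+1}+nH_{n-1}$ for $n\ge1$, and let $\operatorname{Wr}$ denote the Wronskian determinant. Let $\lambda=(\lambda_1\ge\lambda_2\ge\cdots\ge 0)$ be a partition, i.e. a non-increasing finitely supported sequence of non-negative integers, let $N=\sum_i\lambda_i$, and let $\ell$ be the smallest non-negative integer with $\lambda_{\ell+1}=0$. Put $$C^\lambda_\ell=2^{\ell(\ell-1)/2}\prod_{1\le i<j\le \ell}(\lambda_i-\lambda_j+j-i),\qquad \pi^\lambda_l(n)=\prod_{i=1}^l(n-N-\lambda_i+i)\quad(l\ge 0),\qquad m_i=\lambda_i+\ell-i\quad(1\le i\le\ell),$$ $$\eta_\lambda=(C^\lambda_\ell)^{-1}\operatorname{Wr}(H_{m_\ell},\dots,H_{m_1}),\qquad I_\lambda=\{n\in\mathbb N_0: n-N+\ell\ge 0,\ \pi^\lambda_\ell(n)\ne 0\},$$ and, for $n\in I_\lambda$, define the exceptional Hermite polynomial $$H^\lambda_n=\bigl(2^\ell C^\lambda_\ell\,\pi^\lambda_\ell(n)\bigr)^{-1}\operatorname{Wr}(H_{m_\ell},\dots,H_{m_1},H_{n-N+\ell}).$$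 Suppose that $\lambda$ is even, i.e. $\lambda_{2i-1}=\lambda_{2i}$ for every $i\ge1$. Then $\eta_\lambda$ has no real zeros, so that $W_\lambda(x)=\eta_\lambda(x)^{-2}e^{-x^2}$ is a non-singular weight on $\mathbb R$, and for all $n,n'\in I_\lambda$ the function $H^\lambda_nH^\lambda_{n'}W_\lambda$ is integrable on $\mathbb R$ and $$\langle H^\lambda_n,H^\lambda_{n'}\rangle_\lambda:=\int_{\mathbb R}H^\lambda_n(x)H^\lambda_{n'}(x)\,\frac{e^{-x^2}}{\eta_\lambda(x)^2}\,dx=\sqrt{\pi}\,2^{\,n-N}\,\frac{n!}{\pi^\lambda_N(n)}\,\delta_{n,n'}.$$ -/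

import Mathlib

open Polynomial

noncomputable section

namespace ExcHermite

/-- The classical (physicists') Hermite polynomials: `H₀ = 1`, `H₁ = 2x` and
`x H_n = (1/2) H_{n+1} + n H_{n-1}` for `n ≥ 1`. -/
def H : ℕ → ℝ[X]
  | 0 => 1
  | 1 => 2 * X
  | n + 2 => 2 * X * H (n + 1) - C (2 * ((n : ℝ) + 1)) * H n

/-- The Wronskian determinant of a finite list `f 0, …, f (k - 1)` of polynomials. -/
def wr {k : ℕ} (f : Fin k → ℝ[X]) : ℝ[X] :=
  Matrix.det (Matrix.of fun i j : Fin k => derivative^[(i : ℕ)] (f j))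

/-- A partition is a non-increasing, finitely supported sequence of natural numbers. The
sequence is indexed from `0` here, so that `lam i` is the part `λ_{i+1}`. -/
def IsPartition (lam : ℕ →₀ ℕ) : Prop := Antitone lam

/-- The number `N = λ₁ + λ₂ + ⋯` that is partitioned. -/
def size (lam : ℕ →₀ ℕ) : ℕ := lam.sum fun _ a => a

/-- The length of a partition: the smallest `ℓ` such that `λ_{ℓ+1} = 0`. -/
def length (lam : ℕ →₀ ℕ) : ℕ := sInf {l : ℕ | lam l = 0}

/-- A partition is even if `λ_{2i-1} = λ_{2i}` for every `i ≥ 1`. -/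
def IsEven (lam : ℕ →₀ ℕ) : Prop := ∀ i : ℕ, lam (2 * i) = lam (2 * i + 1)

/-- `C^λ_l = 2^{l(l-1)/2} ∏_{1 ≤ i < j ≤ l} (λ_i - λ_j + j - i)`. -/
def constC (lam : ℕ →₀ ℕ) (l : ℕ) : ℝ :=
  2 ^ (l * (l - 1) / 2) *
    ∏ j ∈ Finset.range l, ∏ i ∈ Finset.range j, ((lam i : ℝ) - lam j + j - i)

/-- `π^λ_l(n) = ∏_{i=1}^{l} (n - N - λ_i + i)`. -/
def piLam (lam : ℕ →₀ ℕ) (l : ℕ) (n : ℕ) : ℤ :=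
  ∏ i ∈ Finset.range l, ((n : ℤ) - size lam - lam i + (i + 1))

/-- `m_i = λ_i + ℓ - i` for `1 ≤ i ≤ ℓ`; in zero-based indexing, `m lam i` is `m_{i+1}`. -/
def m (lam : ℕ →₀ ℕ) (i : Fin (length lam)) : ℕ := lam i + (length lam - (i + 1))

/-- The list `H_{m_ℓ}, …, H_{m_1}`. -/
def hermiteList (lam : ℕ →₀ ℕ) : Fin (length lam) → ℝ[X] :=
  fun j => H (m lam j.rev)

/-- `η_λ = (C^λ_ℓ)⁻¹ Wr(H_{m_ℓ}, …, H_{m_1})`. -/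
def eta (lam : ℕ →₀ ℕ) : ℝ[X] :=
  C (constC lam (length lam))⁻¹ * wr (hermiteList lam)

/-- The degree set `I_λ = {n : n - N + ℓ ≥ 0 and π^λ_ℓ(n) ≠ 0}`. -/
def degreeSet (lam : ℕ →₀ ℕ) : Set ℕ :=
  {n | 0 ≤ (n : ℤ) - size lam + length lam ∧ piLam lam (length lam) n ≠ 0}

/-- The exceptional Hermite polynomial
`H^λ_n = (2^ℓ C^λ_ℓ π^λ_ℓ(n))⁻¹ Wr(H_{m_ℓ}, …, H_{m_1}, H_{n-N+ℓ})`, which is meant for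
`n ∈ I_λ`; for such `n` the subtraction `n + ℓ - N` does not truncate. -/
def excH (lam : ℕ →₀ ℕ) (n : ℕ) : ℝ[X] :=
  C (2 ^ length lam * constC lam (length lam) * (piLam lam (length lam) n : ℝ))⁻¹ *
    wr (Fin.snoc (α := fun _ => ℝ[X]) (hermiteList lam) (H (n + length lam - size lam)))

/-- The weight `W_λ = η_λ^{-2} e^{-x²}`. -/
def weight (lam : ℕ →₀ ℕ) (x : ℝ) : ℝ := ((eta lam).eval x ^ 2)⁻¹ * Real.exp (-x ^ 2)

/-- The weighted inner product `⟨f, g⟩_λ = ∫ f g W_λ` of two real polynomials. -/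
def innerLam (lam : ℕ →₀ ℕ) (f g : ℝ[X]) : ℝ :=
  ∫ x : ℝ, f.eval x * g.eval x * weight lam x

end ExcHermite

end

/-!
The proof has two independent parts.

*Orthogonality.* Let `M` be the set of the `m_i`. The function `Wr(M, k) / Wr(M)` is `L H_k`, where
`L` is the monic differential operator of order `ℓ` that annihilates the `H_m` with `m ∈ M`
(`fieldWr_snoc`), and `L` is a product of first-order Darboux transformations `D - σ`. Each of them
keeps the form `φ'' - 2xφ' + qφ = -2kφ` of the Hermite equation, with a new `q`
(`darboux_equation`), and changes the product `φ_k φ_l` into `2 (l - m) φ_k φ_l` plus a term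
`R' - 2xR = e^{x²} (R e^{-x²})'` (`darboux_mul`). The intermediate steps may have poles on the real
line, so all of this is done in the differential field of rational functions. At the end only the
zeros of `Wr(M)` can be poles of `R` (`denominator_no_root`); if there are none on the real line,
then `R e^{-x²}` is smooth and decays, its derivative has integral zero, and
`∫ L H_k · L H_l e^{-x²} = ∏ 2 (l - m) ∫ H_k H_l e^{-x²}` (`integral_wr_mul_wr`).

*Absence of zeros.* For an even partition `M` is a disjoint union of pairs `{b, b + 1}`, so that
`∏ (k - b)(k - b - 1) ≥ 0` for every integer `k`, with equality only for `k ∈ M`. If `Wr(M)` is zero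
at `x₀`, then some nonzero combination `p` of the `H_m`, `m ∈ M`, vanishes to order `ℓ` at `x₀`. The
quadratic form of `∏ (A - b)(A - b - 1)`, where `A` is the Hermite operator, has the value zero at
the function `p 1_{x > x₀}`, by partial integration without boundary terms; by Parseval's identity
this function has no Hermite coefficients outside `M`, so it is a polynomial, which is absurd
(`wr_eval_ne_zero`). Parseval's identity needs the completeness of the Hermite polynomials
(`ae_eq_zero_of_integral_H_mul`).
-/

noncomputable section

namespace ExcHermite

/-! ### Darboux transformations in a differential field -/

section Darboux

variable {K : Type*} [Field K]

/-- The Wronskian determinant of a finite list of elements of a differential field. -/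
def fieldWr (D : Derivation ℤ K K) {k : ℕ} (f : Fin k → K) : K :=
  Matrix.det (Matrix.of fun i j : Fin k => D^[(i : ℕ)] (f j))

/-- The iterated Darboux transformation `L_s = (D - σ_{s-1}) ∘ ⋯ ∘ (D - σ_0)`, in which
`σ_j = D φ / φ` is the logarithmic derivative of `φ = L_j (h (a j))`. It is the monic differential
operator of order `s` that annihilates `h (a 0), …, h (a (s - 1))`, provided that no `φ` is zero;
where `φ = 0`, the junk value of the quotient makes the step `D` instead of `D - σ_j`. -/
def darboux (D : Derivation ℤ K K) (h : ℕ → K) (a : ℕ → ℕ) : ℕ → K → K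
  | 0, f => f
  | s + 1, f =>
    D (darboux D h a s f) -
      D (darboux D h a s (h (a s))) / darboux D h a s (h (a s)) * darboux D h a s f

variable (D : Derivation ℤ K K) (h : ℕ → K) (a : ℕ → ℕ)

theorem derivation_mul (x y : K) : D (x * y) = x * D y + y * D x := D.leibniz x y

theorem darboux_eq_monic (s : ℕ) :
    ∃ c : ℕ → K, ∀ f, darboux D h a s f = D^[s] f + ∑ i ∈ Finset.range s, c i * D^[i] f := by
  induction s with
  | zero => exact ⟨fun _ => 0, fun f => by simp [darboux]⟩
  | succ s ih =>
    obtain ⟨c, hc⟩ := ih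
    set σ := D (darboux D h a s (h (a s))) / darboux D h a s (h (a s))
    refine ⟨fun i => (if i = 0 then 0 else c (i - 1)) +
      (if i = s then -σ else D (c i) - σ * c i), fun f => ?_⟩
    have e1 : ∑ i ∈ Finset.range (s + 1), (if i = 0 then 0 else c (i - 1)) * D^[i] f =
        ∑ i ∈ Finset.range s, c i * D^[i + 1] f := by
      rw [Finset.sum_range_succ']; simp
    have e2 : ∑ i ∈ Finset.range (s + 1), (if i = s then -σ else D (c i) - σ * c i) * D^[i] f =
        ∑ i ∈ Finset.range s, (D (c i) - σ * c i) * D^[i] f - σ * D^[s] f := by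
      rw [Finset.sum_range_succ, if_pos rfl, sub_eq_add_neg, neg_mul]
      congr 1
      refine Finset.sum_congr rfl fun i hi => ?_
      rw [if_neg (Finset.mem_range.1 hi).ne]
    simp only [add_mul, Finset.sum_add_distrib]
    rw [e1, e2]
    change D (darboux D h a s f) - σ * darboux D h a s f = _
    rw [hc f]
    simp only [map_add, map_sum, Derivation.leibniz, smul_eq_mul, Function.iterate_succ_apply',
      mul_add, Finset.sum_add_distrib, Finset.mul_sum, sub_mul, Finset.sum_sub_distrib]
    rw [Finset.sum_congr rfl fun i _ => mul_comm (D^[i] f) (D (c i))]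
    simp only [mul_assoc]
    ring

theorem darboux_succ_eq_zero {s : ℕ} {f : K} (hf : darboux D h a s f = 0) :
    darboux D h a (s + 1) f = 0 := by
  simp [darboux, hf]

theorem darboux_annihilates {s j : ℕ} (hj : j < s) : darboux D h a s (h (a j)) = 0 := by
  induction s with
  | zero => omega
  | succ s ih =>
    rcases Nat.lt_succ_iff_lt_or_eq.1 hj with hlt | rfl
    · exact darboux_succ_eq_zero D h a (ih hlt)
    · by_cases h0 : darboux D h a j (h (a j)) = 0
      · exact darboux_succ_eq_zero D h a h0
      · simp [darboux, h0]

/-- Adding a multiple of each of the other rows to the last one turns the last row of the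
Wronskian matrix into `(0, …, 0, L_s f)`. -/
theorem fieldWr_snoc (s : ℕ) (f : K) :
    fieldWr D (Fin.snoc (α := fun _ => K) (fun j : Fin s => h (a j)) f) =
      fieldWr D (fun j : Fin s => h (a j)) * darboux D h a s f := by
  obtain ⟨c, hc⟩ := darboux_eq_monic D h a s
  unfold fieldWr
  set g : Fin (s + 1) → K := Fin.snoc (α := fun _ => K) (fun j : Fin s => h (a j)) f with hg
  set A : Matrix (Fin (s + 1)) (Fin (s + 1)) K :=
    Matrix.of fun i j : Fin (s + 1) => D^[(i : ℕ)] (g j) with hA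
  -- the coefficients of `L_s`, with leading coefficient `1` in the last row
  let c' : Fin (s + 1) → K := fun i => if (i : ℕ) = s then 1 else c i
  have h1 := Matrix.det_updateRow_sum A (Fin.last s) c'
  have hrow : (∑ k, c' k • A k) = fun j => darboux D h a s (g j) := by
    funext j
    rw [Fin.sum_univ_castSucc, hc]
    simp only [Pi.add_apply, Finset.sum_apply, Pi.smul_apply, smul_eq_mul]
    rw [add_comm]
    congr 1
    · simp [c', hA]
    · rw [Finset.sum_range]
      refine Finset.sum_congr rfl fun i _ => ?_
      simp [c', hA, i.2.ne]
  rw [hrow] at h1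
  have h2 : A.det = (A.updateRow (Fin.last s) fun j => darboux D h a s (g j)).det := by
    rw [h1]; simp [c']
  rw [h2, Matrix.det_succ_row _ (Fin.last s), Fin.sum_univ_castSucc]
  have hzero : ∀ j : Fin s, darboux D h a s (g j.castSucc) = 0 := fun j => by
    rw [hg, Fin.snoc_castSucc]; exact darboux_annihilates D h a j.2
  simp only [Matrix.updateRow_self, hzero, mul_zero, zero_mul, Finset.sum_const_zero, zero_add]
  rw [hg, Fin.snoc_last, ← hg, Even.neg_one_pow (by simp), one_mul, mul_comm]
  congr 2
  ext i j
  simp [Matrix.updateRow_ne, hA, hg, Fin.succAbove_last]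

/-- The Riccati equation of the logarithmic derivative of a solution. -/
theorem riccati (D : Derivation ℤ K K) {t q e φ : K} (hφ : φ ≠ 0)
    (e0 : D (D φ) - 2 * t * D φ + q * φ = -2 * e * φ) :
    D (D φ / φ) = -(D φ / φ) ^ 2 + 2 * t * (D φ / φ) - q - 2 * e := by
  have h1 : D (D φ / φ) * φ + D φ / φ * D φ = D (D φ) := by
    have := D.leibniz (D φ / φ) φ
    rw [div_mul_cancel₀ _ hφ, smul_eq_mul, smul_eq_mul] at this
    rw [this]; ring
  apply mul_right_cancel₀ hφ
  have e2 : D φ / φ * φ = D φ := div_mul_cancel₀ _ hφ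
  linear_combination h1 + e0 + (D φ / φ - 2 * t) * e2

variable {D h a} {t : K} [CharZero K]

/-- The transformed functions `φ_k = L_s (h k)` again solve an equation of Hermite type
`φ'' - 2tφ' + qφ = -2kφ`, and none of them vanishes except `φ_{a 0}, …, φ_{a (s - 1)}`. The
factorizations `(D + σ - 2t)(D - σ)` and `(D - σ)(D + σ - 2t)` of the old and the new operator
give the new potential `q + 2σ' - 2`. -/
theorem darboux_equation (ht : D t = 1) (ha : Function.Injective a)
    (hne : ∀ k, h k ≠ 0) (hode : ∀ k : ℕ, D (D (h k)) - 2 * t * D (h k) = -2 * k * h k) (s : ℕ) :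
    (∃ q, ∀ k : ℕ, D (D (darboux D h a s (h k))) - 2 * t * D (darboux D h a s (h k)) +
      q * darboux D h a s (h k) = -2 * k * darboux D h a s (h k)) ∧
    ∀ k, (∀ j < s, k ≠ a j) → darboux D h a s (h k) ≠ 0 := by
  induction s with
  | zero => exact ⟨⟨0, fun k => by simpa [darboux] using hode k⟩, fun k _ => hne k⟩
  | succ s ih =>
    obtain ⟨⟨q, hq⟩, hnz⟩ := ih
    have hφ : darboux D h a s (h (a s)) ≠ 0 :=
      hnz _ fun j hj hEq => hj.ne (ha hEq).symm
    have e0 := hq (a s)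
    set φ := darboux D h a s (h (a s)) with hφdef
    have hD2 : D (2 : K) = 0 := by simpa using D.map_natCast 2
    have hDn : ∀ n : ℕ, D (n : K) = 0 := fun n => D.map_natCast n
    have hric := riccati D hφ e0
    have hstep : ∀ f, darboux D h a (s + 1) f =
        D (darboux D h a s f) - D φ / φ * darboux D h a s f := fun _ => rfl
    refine ⟨⟨q + 2 * D (D φ / φ) - 2, fun k => ?_⟩, fun k hk h0 => ?_⟩
    · rw [hstep]
      set σ := D φ / φ
      have ek := hq k
      set ψ := darboux D h a s (h k)
      have ek' : D (D (D ψ)) - 2 * t * D (D ψ) - 2 * D ψ + q * D ψ + D q * ψ = -2 * k * D ψ := by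
        have := congrArg D ek
        simp only [map_add, map_sub, Derivation.leibniz, smul_eq_mul, ht, hD2, hDn, map_neg] at this
        linear_combination this
      have hric' : D (D σ) = -2 * σ * D σ + 2 * t * D σ + 2 * σ - D q := by
        have := congrArg D hric
        simp only [map_add, map_sub, Derivation.leibniz, smul_eq_mul, ht, hD2, hDn, map_neg,
          pow_two] at this
        linear_combination this
      simp only [map_sub, map_add, Derivation.leibniz, smul_eq_mul]
      linear_combination ek' - σ * ek - ψ * hric'
    -- if `(D - σ) φ_k = 0`, then `φ_k` solves the equations with `k` and with `a s`
    · rw [hstep, sub_eq_zero] at h0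
      have ek := hq k
      have hk0 : darboux D h a s (h k) ≠ 0 := hnz k fun j hj => hk j (by omega)
      set σ := D φ / φ
      set ψ := darboux D h a s (h k)
      have h0' : D (D ψ) = D σ * ψ + σ * D ψ := by
        have := congrArg D h0
        simp only [Derivation.leibniz, smul_eq_mul] at this
        linear_combination this
      have : (2 * ((k : K) - a s)) * ψ = 0 := by
        linear_combination ek - h0' - ψ * hric + (2 * t - σ) * h0
      have h2 := (mul_eq_zero.1 this).resolve_right hk0
      have h3 := (mul_eq_zero.1 h2).resolve_left two_ne_zero
      exact hk s (by omega) (by exact_mod_cast sub_eq_zero.1 h3)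

/-- Up to a total derivative `R' - 2tR`, the product of two transformed functions is a multiple of
the product of the original ones. -/
theorem darboux_mul (ht : D t = 1) (ha : Function.Injective a)
    (hne : ∀ k, h k ≠ 0) (hode : ∀ k : ℕ, D (D (h k)) - 2 * t * D (h k) = -2 * k * h k)
    (k l s : ℕ) :
    ∃ R, darboux D h a s (h k) * darboux D h a s (h l) =
      D R - 2 * t * R + (∏ j ∈ Finset.range s, (2 * ((l : K) - a j))) * (h k * h l) := by
  induction s with
  | zero => exact ⟨0, by simp [darboux]⟩
  | succ s ih =>
    obtain ⟨R, hR⟩ := ih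
    obtain ⟨⟨q, hq⟩, hnz⟩ := darboux_equation ht ha hne hode s
    have hφ : darboux D h a s (h (a s)) ≠ 0 :=
      hnz _ fun j hj hEq => hj.ne (ha hEq).symm
    have e0 := hq (a s)
    have el := hq l
    have hstep : ∀ f, darboux D h a (s + 1) f = D (darboux D h a s f) -
      D (darboux D h a s (h (a s))) / darboux D h a s (h (a s)) * darboux D h a s f := fun _ => rfl
    set φ := darboux D h a s (h (a s))
    -- moving `D - σ` from `φ_k` to the other factor by partial integration produces the boundary
    -- term `φ_k · (D - σ) φ_l`
    refine ⟨darboux D h a s (h k) * darboux D h a (s + 1) (h l) + 2 * ((l : K) - a s) * R, ?_⟩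
    rw [Finset.prod_range_succ, hstep, hstep]
    set u := darboux D h a s (h k)
    set v := darboux D h a s (h l)
    have hD2 : D (2 : K) = 0 := by simpa using D.map_natCast 2
    have hDn : ∀ n : ℕ, D (n : K) = 0 := fun n => D.map_natCast n
    simp only [map_sub, map_add, Derivation.leibniz, smul_eq_mul, hD2, hDn]
    have hric := riccati D hφ e0
    set σ := D φ / φ
    linear_combination (2 * ((l : K) - a s)) * hR - u * el + u * v * hric

end Darboux

/-! ### The derivation of the field of rational functions -/

section Fraction

variable (A K : Type*) [CommRing A] [Field K] [Algebra A K] [IsFractionRing A K]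

/-- The derivation `d` of `A` as a ring homomorphism `f ↦ f + ε d f` into the dual numbers of the
fraction field. -/
def dualHom (d : Derivation ℤ A A) : A →+* TrivSqZeroExt K K where
  toFun f := TrivSqZeroExt.inl (algebraMap A K f) + TrivSqZeroExt.inr (algebraMap A K (d f))
  map_one' := by ext <;> simp
  map_zero' := by ext <;> simp
  map_mul' f g := by
    ext
    · simp
    · simp only [Derivation.leibniz, smul_eq_mul, map_add, map_mul, TrivSqZeroExt.snd_mul,
        TrivSqZeroExt.fst_add, TrivSqZeroExt.snd_add, TrivSqZeroExt.fst_inl, TrivSqZeroExt.snd_inl,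
        TrivSqZeroExt.fst_inr, TrivSqZeroExt.snd_inr, op_smul_eq_smul, add_zero, zero_add]
  map_add' f g := by ext <;> simp [Algebra.smul_def]

theorem isUnit_dualHom (d : Derivation ℤ A A) (y : nonZeroDivisors A) :
    IsUnit (dualHom A K d y) := by
  rw [TrivSqZeroExt.isUnit_iff_isUnit_fst]
  simpa [dualHom] using IsLocalization.map_units K y

/-- The extension of a derivation of a domain to its fraction field: the `ε`-part of the extension
of `f ↦ f + ε d f`. -/
def fractionDerivation (d : Derivation ℤ A A) : Derivation ℤ K K :=
  let φ : K →+* TrivSqZeroExt K K :=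
    IsLocalization.lift (M := nonZeroDivisors A) (isUnit_dualHom A K d)
  have hfst : ∀ x, (φ x).fst = x := fun x => by
    have : ((TrivSqZeroExt.fstHom K K K).toRingHom.comp φ) = RingHom.id K := by
      apply IsLocalization.ringHom_ext (nonZeroDivisors A)
      ext f
      simp [φ, dualHom]
    exact congrArg (fun g : K →+* K => g x) this
  Derivation.mk' (((TrivSqZeroExt.sndHom K K).toAddMonoidHom.comp φ.toAddMonoidHom).toIntLinearMap)
    fun x y => by
      simp [hfst, mul_comm]

variable {A K}

theorem fractionDerivation_algebraMap (d : Derivation ℤ A A) (f : A) :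
    fractionDerivation A K d (algebraMap A K f) = algebraMap A K (d f) := by
  simp [fractionDerivation, dualHom, -algebraMap_smul]

theorem fractionDerivation_iterate_algebraMap (d : Derivation ℤ A A) (n : ℕ) (f : A) :
    (fractionDerivation A K d)^[n] (algebraMap A K f) = algebraMap A K (d^[n] f) := by
  induction n with
  | zero => rfl
  | succ n ih => rw [Function.iterate_succ_apply', ih, fractionDerivation_algebraMap,
      Function.iterate_succ_apply']

end Fraction

/-! ### Wronskians of Hermite polynomials -/

theorem H_succ (n : ℕ) : H (n + 1) = 2 * X * H n - derivative (H n) ∧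
    derivative (H (n + 1)) = C (2 * ((n : ℝ) + 1)) * H n := by
  induction n with
  | zero => simp [H, map_ofNat]
  | succ n ih =>
    have h1 : H (n + 2) = 2 * X * H (n + 1) - C (2 * ((n : ℝ) + 1)) * H n := rfl
    have h2 : H (n + 1 + 1) = 2 * X * H (n + 1) - derivative (H (n + 1)) := by
      rw [ih.2]; exact h1
    refine ⟨h2, ?_⟩
    rw [show n + 1 + 1 = n + 2 from rfl, h1]
    simp only [derivative_sub, derivative_mul, derivative_X, ih.2, derivative_C]
    simp only [derivative_ofNat]
    have h3 := ih.1
    push_cast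
    simp only [C_mul, C_add, C_1]
    have : (C (2 : ℝ)) = (2 : ℝ[X]) := map_ofNat C 2
    rw [this]
    linear_combination (-2 * ((C (n : ℝ)) + 1)) * h3

theorem derivative_derivative_H (k : ℕ) :
    derivative (derivative (H k)) - 2 * X * derivative (H k) = -2 * (k : ℝ[X]) * H k := by
  cases k with
  | zero => simp [H]
  | succ n =>
    have h1 := (H_succ n).2
    have h2 := (H_succ n).1
    rw [h1, h2]
    simp only [derivative_mul, derivative_C]
    have : (C (2 : ℝ)) = (2 : ℝ[X]) := map_ofNat C 2
    simp only [C_mul, C_add, C_1, this, map_natCast]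
    push_cast
    ring

theorem H_ne_zero (n : ℕ) : H n ≠ 0 := by
  induction n with
  | zero => exact one_ne_zero
  | succ n ih =>
    intro h0
    have h1 := (H_succ n).2
    rw [h0, derivative_zero] at h1
    refine (mul_ne_zero ?_ ih) h1.symm
    rw [Ne, C_eq_zero]
    positivity

section RationalFunctions

/-- The derivation `d/dx` of the ring of polynomials, as a `ℤ`-derivation. -/
def polyD : Derivation ℤ ℝ[X] ℝ[X] :=
  (derivative' (R := ℝ)).restrictScalars ℤ

/-- The field of rational functions. -/
local notation "𝕂" => RatFunc ℝ

/-- The inclusion of the polynomials into the rational functions. -/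
local notation "ι" => algebraMap ℝ[X] (RatFunc ℝ)

/-- The derivation `d/dx` of the field of rational functions. The type is left to be inferred, since
`Derivation ℤ 𝕂 𝕂` would find a different `ℤ`-algebra structure on `RatFunc ℝ`. -/
def ratD := fractionDerivation ℝ[X] 𝕂 polyD

theorem ratD_algebraMap (f : ℝ[X]) : ratD (ι f) = ι (derivative f) :=
  fractionDerivation_algebraMap polyD f

theorem ratD_ratD_H (k : ℕ) :
    ratD (ratD (ι (H k))) - 2 * ι X * ratD (ι (H k)) = -2 * (k : 𝕂) * ι (H k) := by
  have := congrArg ι (derivative_derivative_H k)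
  simp only [ratD_algebraMap]
  simpa only [map_sub, map_mul, map_neg, map_natCast, map_ofNat] using this

theorem fieldWr_algebraMap {k : ℕ} (f : Fin k → ℝ[X]) :
    fieldWr ratD (fun j => ι (f j)) = ι (wr f) := by
  unfold fieldWr wr
  rw [RingHom.map_det]
  congr 1
  ext i j
  exact fractionDerivation_iterate_algebraMap polyD i (f j)

/-- The product of two Wronskians `Wr(M, k) Wr(M, l)`, divided by `Wr(M)²`, agrees with
`∏ 2 (l - m) H_k H_l` up to `e^{x²} (R e^{-x²})'` for a rational function `R = f / g`. -/
theorem wr_mul_wr {a : ℕ → ℕ} (ha : Function.Injective a) (s k l : ℕ) :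
    ∃ f g : ℝ[X], g ≠ 0 ∧ IsCoprime f g ∧
      wr (fun j : Fin s => H (a j)) ^ 2 *
        (derivative f * g - f * derivative g - 2 * X * f * g) =
      (wr (Fin.snoc (α := fun _ => ℝ[X]) (fun j : Fin s => H (a j)) (H k)) *
        wr (Fin.snoc (α := fun _ => ℝ[X]) (fun j : Fin s => H (a j)) (H l)) -
        C (∏ j ∈ Finset.range s, (2 * ((l : ℝ) - a j))) * (H k * H l) *
          wr (fun j : Fin s => H (a j)) ^ 2) * g ^ 2 := by
  have hι : Function.Injective ι := IsFractionRing.injective ℝ[X] 𝕂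
  obtain ⟨R, hR⟩ := darboux_mul (D := ratD) (h := fun k => ι (H k)) (a := a) (t := ι X)
    (by rw [ratD_algebraMap, derivative_X, map_one]) ha
    (fun k => (map_ne_zero_iff ι hι).2 (H_ne_zero k)) ratD_ratD_H k l s
  obtain ⟨f, g, hrel, hfg⟩ := IsFractionRing.exists_reduced_fraction ℝ[X] R
  have hg0 : (g : ℝ[X]) ≠ 0 := nonZeroDivisors.coe_ne_zero g
  have hιg : ι (g : ℝ[X]) ≠ 0 := (map_ne_zero_iff ι hι).2 hg0
  refine ⟨f, g, hg0, hrel.isCoprime, hι ?_⟩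
  have hRg : R * ι g = ι f := by rw [← hfg]; exact IsLocalization.mk'_spec _ _ _
  have hDR : ratD R * ι g + R * ι (derivative g) = ι (derivative f) := by
    have := congrArg ratD hRg
    rw [derivation_mul, ratD_algebraMap, ratD_algebraMap] at this
    linear_combination this
  have hs : ∀ n, ι (wr (Fin.snoc (α := fun _ => ℝ[X]) (fun j : Fin s => H (a j)) (H n))) =
      ι (wr (fun j : Fin s => H (a j))) * darboux ratD (fun k => ι (H k)) a s (ι (H n)) := by
    intro n
    rw [← fieldWr_algebraMap, ← fieldWr_algebraMap, ← fieldWr_snoc ratD (fun k => ι (H k)) a s]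
    congr 1
    funext j
    refine Fin.lastCases ?_ (fun i => ?_) j <;> simp
  have hC : ι (C (∏ j ∈ Finset.range s, (2 * ((l : ℝ) - a j)))) =
      ∏ j ∈ Finset.range s, (2 * ((l : 𝕂) - a j)) := by
    simp [map_prod, map_ofNat]
  simp only [map_mul, map_sub, map_pow, hs, hC, map_ofNat]
  set W := ι (wr (fun j : Fin s => H (a j)))
  set c := ∏ j ∈ Finset.range s, (2 * ((l : 𝕂) - a j))
  rw [← hDR, ← hRg]
  linear_combination (-W ^ 2 * ι (g : ℝ[X]) ^ 2) * hR

end RationalFunctions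

/-! ### Polynomials against the Gaussian weight -/

open Filter Topology MeasureTheory

theorem integrable_eval_mul_gauss (p : ℝ[X]) :
    Integrable fun x : ℝ => p.eval x * Real.exp (-x ^ 2) := by
  induction p using Polynomial.induction_on' with
  | add p q hp hq =>
    simp only [eval_add, add_mul]
    exact hp.add hq
  | monomial n c =>
    have := (integrable_rpow_mul_exp_neg_mul_sq (b := 1) one_pos (s := n)
      (by have : (0 : ℝ) ≤ n := Nat.cast_nonneg n
          linarith)).const_mul c
    simpa [mul_assoc] using this

theorem tendsto_eval_mul_gauss (p : ℝ[X]) :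
    Tendsto (fun x : ℝ => p.eval x * Real.exp (-x ^ 2)) (cocompact ℝ) (𝓝 0) := by
  induction p using Polynomial.induction_on' with
  | add p q hp hq => simpa [add_mul] using hp.add hq
  | monomial n c =>
    have h := tendsto_rpow_abs_mul_exp_neg_mul_sq_cocompact (a := 1) one_pos n
    rw [tendsto_zero_iff_norm_tendsto_zero]
    simpa [abs_mul, mul_assoc] using h.const_mul |c|

theorem exists_inv_eval_bound {g : ℝ[X]} (hg : ∀ x : ℝ, g.eval x ≠ 0) :
    ∃ B : ℝ, ∀ x : ℝ, |(g.eval x)⁻¹| ≤ B := by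
  have hcont : Continuous fun x : ℝ => |g.eval x| := g.continuous.abs
  by_cases hd : 0 < g.degree
  · have ht : Tendsto (fun x : ℝ => |g.eval x|) (cocompact ℝ) atTop :=
      g.tendsto_norm_atTop hd tendsto_norm_cocompact_atTop
    obtain ⟨x₀, hx₀⟩ := hcont.exists_forall_le ht
    refine ⟨|g.eval x₀|⁻¹, fun x => ?_⟩
    rw [abs_inv]
    exact inv_anti₀ (abs_pos.2 (hg x₀)) (hx₀ x)
  · rw [eq_C_of_degree_le_zero (not_lt.1 hd)]
    exact ⟨_, fun x => by rw [eval_C]⟩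

theorem integrable_eval_div_mul_gauss (f : ℝ[X]) {g : ℝ[X]} (hg : ∀ x : ℝ, g.eval x ≠ 0) :
    Integrable fun x : ℝ => f.eval x / g.eval x * Real.exp (-x ^ 2) := by
  obtain ⟨B, hB⟩ := exists_inv_eval_bound hg
  have h := (integrable_eval_mul_gauss f).bdd_mul (c := B)
    (f := fun x => (g.eval x)⁻¹)
    (g.continuous.inv₀ hg).aestronglyMeasurable (Eventually.of_forall hB)
  refine h.congr (Eventually.of_forall fun x => ?_)
  simp only [div_eq_mul_inv]; ring

theorem tendsto_eval_div_mul_gauss (f : ℝ[X]) {g : ℝ[X]} (hg : ∀ x : ℝ, g.eval x ≠ 0) :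
    Tendsto (fun x : ℝ => f.eval x / g.eval x * Real.exp (-x ^ 2)) (cocompact ℝ) (𝓝 0) := by
  obtain ⟨B, hB⟩ := exists_inv_eval_bound hg
  have h := (tendsto_eval_mul_gauss f).norm.const_mul B
  rw [norm_zero, mul_zero] at h
  refine squeeze_zero_norm (fun x => ?_) h
  rw [div_eq_mul_inv, mul_right_comm, norm_mul, mul_comm]
  exact mul_le_mul_of_nonneg_right (hB x) (norm_nonneg _)

theorem hasDerivAt_gauss (x : ℝ) :
    HasDerivAt (fun x : ℝ => Real.exp (-x ^ 2)) (-2 * x * Real.exp (-x ^ 2)) x := by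
  have := ((hasDerivAt_pow 2 x).fun_neg).exp
  refine this.congr_deriv ?_
  push_cast; ring

theorem hasDerivAt_eval_div_mul_gauss (f : ℝ[X]) {g : ℝ[X]} {x : ℝ} (hg : g.eval x ≠ 0) :
    HasDerivAt (fun x : ℝ => f.eval x / g.eval x * Real.exp (-x ^ 2))
      ((derivative f * g - f * derivative g - 2 * X * f * g).eval x / (g ^ 2).eval x *
        Real.exp (-x ^ 2)) x := by
  have := ((f.hasDerivAt x).div (g.hasDerivAt x) hg).mul (hasDerivAt_gauss x)
  refine this.congr_deriv ?_
  simp only [eval_sub, eval_mul, eval_pow, eval_X, eval_ofNat, Pi.div_apply]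
  field_simp
  ring

theorem integral_deriv_div_mul_gauss (f : ℝ[X]) {g : ℝ[X]} (hg : ∀ x : ℝ, g.eval x ≠ 0) :
    ∫ x : ℝ, (derivative f * g - f * derivative g - 2 * X * f * g).eval x / (g ^ 2).eval x *
      Real.exp (-x ^ 2) = 0 := by
  have hg2 : ∀ x : ℝ, (g ^ 2).eval x ≠ 0 := fun x => by
    rw [eval_pow]; exact pow_ne_zero 2 (hg x)
  have ht := tendsto_eval_div_mul_gauss f hg
  have := integral_of_hasDerivAt_of_tendsto
    (fun x => hasDerivAt_eval_div_mul_gauss f (hg x)) (integrable_eval_div_mul_gauss _ hg2)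
    (ht.mono_left atBot_le_cocompact) (ht.mono_left atTop_le_cocompact)
  rw [this, sub_zero]

theorem integral_H_succ_mul (n : ℕ) (f : ℝ[X]) :
    ∫ x : ℝ, (H (n + 1) * f).eval x * Real.exp (-x ^ 2) =
      ∫ x : ℝ, (H n * derivative f).eval x * Real.exp (-x ^ 2) := by
  have h := integral_deriv_div_mul_gauss (H n * f) (g := 1) (by simp)
  rw [← sub_eq_zero, ← integral_sub (integrable_eval_mul_gauss _) (integrable_eval_mul_gauss _),
    ← neg_eq_zero, ← integral_neg, ← h]
  congr 1
  funext x
  rw [(H_succ n).1]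
  simp only [derivative_mul, derivative_one, eval_sub, eval_mul, eval_pow, eval_one, eval_add,
    eval_zero]
  ring

theorem integral_H_mul_H (k l : ℕ) :
    ∫ x : ℝ, (H k * H l).eval x * Real.exp (-x ^ 2) =
      if k = l then Real.sqrt Real.pi * (2 ^ k * (Nat.factorial k : ℝ)) else 0 := by
  induction k generalizing l with
  | zero =>
    cases l with
    | zero =>
      have := integral_gaussian 1
      simpa [H] using this
    | succ l =>
      rw [mul_comm, integral_H_succ_mul]
      simp [H]
  | succ k ih =>
    rw [integral_H_succ_mul]
    cases l with
    | zero => simp [H]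
    | succ l =>
      have : ∀ x : ℝ, (H k * derivative (H (l + 1))).eval x * Real.exp (-x ^ 2) =
          (2 * ((l : ℝ) + 1)) * ((H k * H l).eval x * Real.exp (-x ^ 2)) := fun x => by
        rw [(H_succ l).2]; simp only [eval_mul, eval_C]; ring
      simp only [this]
      rw [integral_const_mul, ih]
      by_cases hkl : k = l
      · subst hkl
        simp only [if_true, Nat.factorial_succ]
        push_cast
        ring
      · simp [hkl]

/-- A pole of `f / g` in lowest terms would be a pole of `(f / g)' - 2x f / g` as well. -/
theorem denominator_no_root {f g W s : ℝ[X]} (hg : g ≠ 0) (hfg : IsCoprime f g)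
    (h : W ^ 2 * (derivative f * g - f * derivative g - 2 * X * f * g) = s * g ^ 2) {x : ℝ}
    (hW : W.eval x ≠ 0) : g.eval x ≠ 0 := by
  intro hx
  have hdvd : g ∣ W ^ 2 * derivative g := by
    have : g ∣ f * (W ^ 2 * derivative g) :=
      ⟨W ^ 2 * derivative f - W ^ 2 * (2 * X * f) - s * g, by linear_combination -h⟩
    exact hfg.symm.dvd_of_dvd_mul_left this
  have hroot : g.IsRoot x := hx
  have hg' : derivative g ≠ 0 := by
    intro h0
    have := derivative_eq_zero.1 h0
    rw [eq_C_of_natDegree_eq_zero this, eval_C] at hx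
    rw [eq_C_of_natDegree_eq_zero this, hx, C_0] at hg
    exact hg rfl
  have hW0 : W ≠ 0 := by rintro rfl; simp at hW
  have hne : W ^ 2 * derivative g ≠ 0 := mul_ne_zero (pow_ne_zero 2 hW0) hg'
  have hle := rootMultiplicity_le_rootMultiplicity_of_dvd hne hdvd x
  have hW2 : (W ^ 2).rootMultiplicity x = 0 :=
    rootMultiplicity_eq_zero (by simpa [IsRoot] using hW)
  rw [rootMultiplicity_mul hne, hW2, zero_add, derivative_rootMultiplicity_of_root hroot] at hle
  have := (rootMultiplicity_pos hg).2 hroot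
  omega

/-- The inner products of the functions `Wr(M, k) / Wr(M)`, in which `M` is the list
`H_{a 0}, …, H_{a (s - 1)}`. -/
theorem integral_wr_mul_wr {a : ℕ → ℕ} (ha : Function.Injective a) (s k l : ℕ)
    (hW : ∀ x : ℝ, (wr fun j : Fin s => H (a j)).eval x ≠ 0) :
    ∫ x : ℝ, (wr (Fin.snoc (α := fun _ => ℝ[X]) (fun j : Fin s => H (a j)) (H k)) *
        wr (Fin.snoc (α := fun _ => ℝ[X]) (fun j : Fin s => H (a j)) (H l))).eval x /
          ((wr fun j : Fin s => H (a j)) ^ 2).eval x * Real.exp (-x ^ 2) =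
      (∏ j ∈ Finset.range s, (2 * ((l : ℝ) - a j))) *
        if k = l then Real.sqrt Real.pi * (2 ^ k * (Nat.factorial k : ℝ)) else 0 := by
  obtain ⟨f, g, hg0, hfg, h⟩ := wr_mul_wr ha s k l
  have hg : ∀ x : ℝ, g.eval x ≠ 0 := fun x => denominator_no_root hg0 hfg h (hW x)
  have hg2 : ∀ x : ℝ, (g ^ 2).eval x ≠ 0 := fun x => by
    rw [eval_pow]; exact pow_ne_zero 2 (hg x)
  have hW2 : ∀ x : ℝ, ((wr fun j : Fin s => H (a j)) ^ 2).eval x ≠ 0 := fun x => by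
    rw [eval_pow]; exact pow_ne_zero 2 (hW x)
  rw [← integral_H_mul_H, ← integral_const_mul, ← sub_eq_zero, ← integral_sub
    (integrable_eval_div_mul_gauss _ hW2) ((integrable_eval_mul_gauss _).const_mul _),
    ← integral_deriv_div_mul_gauss f hg]
  congr 1
  funext x
  have key : ∀ (A V E G P : ℝ[X]) (c : ℝ), V * E = (A - C c * P * V) * G → V.eval x ≠ 0 →
      G.eval x ≠ 0 → A.eval x / V.eval x * Real.exp (-x ^ 2) - c * (P.eval x * Real.exp (-x ^ 2)) =
        E.eval x / G.eval x * Real.exp (-x ^ 2) := by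
    intro A V E G P c hVE hV hG
    have := congrArg (eval x) hVE
    simp only [eval_mul, eval_sub, eval_C] at this
    field_simp
    linear_combination -this
  exact key _ _ _ _ _ _ h (hW2 x) (hg2 x)

/-! ### Completeness of the Hermite polynomials -/

/-- The measure `e^{-x²} dx` on the real line. -/
def gaussM : Measure ℝ := volume.withDensity fun x => ENNReal.ofReal (Real.exp (-x ^ 2))

theorem measurable_gauss_density :
    Measurable fun x : ℝ => ENNReal.ofReal (Real.exp (-x ^ 2)) := by fun_prop

theorem integrable_gaussM_iff {f : ℝ → ℝ} :
    Integrable f gaussM ↔ Integrable fun x => f x * Real.exp (-x ^ 2) := by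
  rw [gaussM, integrable_withDensity_iff_integrable_smul' measurable_gauss_density
    (Eventually.of_forall fun _ => ENNReal.ofReal_lt_top)]
  simp [ENNReal.toReal_ofReal (Real.exp_pos _).le, mul_comm]

theorem integral_gaussM (f : ℝ → ℝ) :
    ∫ x, f x ∂gaussM = ∫ x, f x * Real.exp (-x ^ 2) := by
  rw [gaussM, integral_withDensity_eq_integral_toReal_smul measurable_gauss_density
    (Eventually.of_forall fun _ => ENNReal.ofReal_lt_top)]
  simp [ENNReal.toReal_ofReal (Real.exp_pos _).le, mul_comm]

theorem ae_gaussM_iff {p : ℝ → Prop} : (∀ᵐ x ∂gaussM, p x) ↔ ∀ᵐ x : ℝ, p x := by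
  rw [gaussM, ae_withDensity_iff measurable_gauss_density]
  simp [Real.exp_pos]

instance : IsFiniteMeasure gaussM := by
  refine isFiniteMeasure_withDensity_ofReal ?_
  simpa using (integrable_eval_mul_gauss 1).hasFiniteIntegral

theorem memLp_eval (p : ℝ[X]) : MemLp (fun x : ℝ => p.eval x) 2 gaussM := by
  rw [memLp_two_iff_integrable_sq p.continuous.aestronglyMeasurable, integrable_gaussM_iff]
  have h := integrable_eval_mul_gauss (p ^ 2)
  simp only [eval_pow] at h
  exact h

theorem memLp_exp_abs (t : ℝ) : MemLp (fun x : ℝ => Real.exp |t * x|) 2 gaussM := by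
  rw [memLp_two_iff_integrable_sq (by fun_prop), integrable_gaussM_iff]
  have h := (integrable_exp_neg_mul_sq (b := 1 / 2) (by norm_num)).const_mul
    (Real.exp (2 * t ^ 2))
  refine h.mono' (by fun_prop) (Eventually.of_forall fun x => ?_)
  rw [Real.norm_of_nonneg (by positivity), ← Real.exp_nat_mul, ← Real.exp_add, ← Real.exp_add,
    Real.exp_le_exp, abs_mul]
  push_cast
  -- `2|tx| ≤ 2t² + x² / 2`
  nlinarith [sq_nonneg (|x| - 2 * |t|), sq_abs x, sq_abs t]

/-- A function is determined by its Fourier transform with respect to a finite measure: the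
measures with densities `f⁺` and `f⁻` have the same characteristic function. -/
theorem ae_eq_zero_of_integral_cexp {μ : Measure ℝ} {f : ℝ → ℝ} (hfm : Measurable f)
    (hf : Integrable f μ)
    (h : ∀ t : ℝ, ∫ x, Complex.exp (t * x * Complex.I) * (f x : ℂ) ∂μ = 0) : f =ᵐ[μ] 0 := by
  have hdens : ∀ {g : ℝ → ℝ}, Measurable g → Integrable g μ → ∀ t : ℝ,
      charFun (μ.withDensity fun x => ENNReal.ofReal (g x)) t =
        ∫ x, Complex.exp (t * x * Complex.I) * ((max (g x) 0 : ℝ) : ℂ) ∂μ := by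
    intro g hg _ t
    rw [charFun_apply_real, integral_withDensity_eq_integral_toReal_smul hg.ennreal_ofReal
      (Eventually.of_forall fun _ => ENNReal.ofReal_lt_top)]
    congr 1
    funext x
    rw [ENNReal.toReal_ofReal', Complex.real_smul, mul_comm]
  have hint : ∀ {g : ℝ → ℝ}, Integrable g μ → ∀ t : ℝ,
      Integrable (fun x : ℝ => Complex.exp (t * x * Complex.I) * ((max (g x) 0 : ℝ) : ℂ)) μ := by
    intro g hg t
    refine (hg.pos_part.ofReal (𝕜 := ℂ)).bdd_mul (c := 1) (by fun_prop)
      (Eventually.of_forall fun x => ?_)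
    rw [← Complex.ofReal_mul, Complex.norm_exp_ofReal_mul_I]
  have := isFiniteMeasure_withDensity_ofReal hf.2
  have := isFiniteMeasure_withDensity_ofReal hf.neg.2
  have heq : (μ.withDensity fun x => ENNReal.ofReal (f x)) =
      μ.withDensity fun x => ENNReal.ofReal ((-f) x) := by
    refine Measure.ext_of_charFun (funext fun t => ?_)
    rw [hdens hfm hf, hdens hfm.neg hf.neg, ← sub_eq_zero,
      ← integral_sub (hint hf t) (hint hf.neg t), ← h t]
    congr 1
    funext x
    rw [← mul_sub, ← Complex.ofReal_sub]
    congr 2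
    rcases le_total (f x) 0 with h0 | h0 <;> simp [h0]
  rw [withDensity_eq_iff hfm.ennreal_ofReal.aemeasurable hfm.neg.ennreal_ofReal.aemeasurable
    hf.lintegral_lt_top.ne] at heq
  filter_upwards [heq] with x hx
  rw [Pi.zero_apply]
  rcases le_total (f x) 0 with h0 | h0
  · have : ENNReal.ofReal ((-f) x) = 0 := by rw [← hx]; exact ENNReal.ofReal_of_nonpos h0
    rw [ENNReal.ofReal_eq_zero, Pi.neg_apply] at this
    linarith
  · have : ENNReal.ofReal (f x) = 0 := by
      rw [hx]; exact ENNReal.ofReal_of_nonpos (by rw [Pi.neg_apply]; linarith)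
    rw [ENNReal.ofReal_eq_zero] at this
    linarith

theorem integrable_eval_mul {f : ℝ → ℝ} (hf : MemLp f 2 gaussM) (p : ℝ[X]) :
    Integrable (fun x => p.eval x * f x) gaussM :=
  (memLp_eval p).integrable_mul hf

theorem integral_eval_mul_eq_zero {f : ℝ → ℝ} (hf : MemLp f 2 gaussM)
    (h : ∀ k, ∫ x, (H k).eval x * f x ∂gaussM = 0) (p : ℝ[X]) :
    ∫ x, p.eval x * f x ∂gaussM = 0 := by
  have hadd : ∀ p q : ℝ[X], ∫ x, (p + q).eval x * f x ∂gaussM =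
      ∫ x, p.eval x * f x ∂gaussM + ∫ x, q.eval x * f x ∂gaussM := fun p q => by
    rw [← integral_add (integrable_eval_mul hf p) (integrable_eval_mul hf q)]
    simp [add_mul]
  have hsmul : ∀ (c : ℝ) (p : ℝ[X]), ∫ x, (C c * p).eval x * f x ∂gaussM =
      c * ∫ x, p.eval x * f x ∂gaussM := fun c p => by
    rw [← integral_const_mul]
    simp [mul_assoc]
  -- the recurrence `x H_k = H_{k+1} / 2 + k H_{k-1}` reduces `x^(n+1) H_k` to `x^n H_{k±1}`
  have hX : ∀ n k, ∫ x, (X ^ n * H k).eval x * f x ∂gaussM = 0 := by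
    intro n
    induction n with
    | zero => simpa using h
    | succ n ih =>
      intro k
      have h2 : C (1 / 2 : ℝ) * 2 = 1 := by
        rw [show (2 : ℝ[X]) = C 2 from (map_ofNat C 2).symm, ← C_mul]; simp
      cases k with
      | zero =>
        have : X ^ (n + 1) * H 0 = C (1 / 2 : ℝ) * (X ^ n * H 1) := by
          simp only [H]; linear_combination (-X ^ (n + 1)) * h2
        rw [this, hsmul, ih, mul_zero]
      | succ k =>
        have : X ^ (n + 1) * H (k + 1) = C (1 / 2 : ℝ) * (X ^ n * H (k + 2)) +
            C ((k : ℝ) + 1) * (X ^ n * H k) := by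
          have e : H (k + 2) = 2 * X * H (k + 1) - C (2 * ((k : ℝ) + 1)) * H k := rfl
          rw [e, C_mul, show C (2 : ℝ) = 2 from map_ofNat C 2]
          linear_combination (X ^ n * C ((k : ℝ) + 1) * H k - X ^ (n + 1) * H (k + 1)) * h2
        rw [this, hadd, hsmul, hsmul, ih, ih, mul_zero, mul_zero, add_zero]
  induction p using Polynomial.induction_on' with
  | add p q hp hq => rw [hadd, hp, hq, add_zero]
  | monomial n c =>
    rw [← C_mul_X_pow_eq_monomial, hsmul]
    have := hX n 0
    simp only [H, mul_one] at this
    rw [this, mul_zero]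

/-- Completeness of the Hermite polynomials in `L²(e^{-x²} dx)`: if all moments of `f` vanish,
then integrating the power series of `e^{itx}` term by term shows that its Fourier transform
vanishes. -/
theorem ae_eq_zero_of_integral_H_mul {f : ℝ → ℝ} (hfm : Measurable f) (hf : MemLp f 2 gaussM)
    (h : ∀ k, ∫ x, (H k).eval x * f x ∂gaussM = 0) : f =ᵐ[gaussM] 0 := by
  refine ae_eq_zero_of_integral_cexp hfm (hf.integrable (by norm_num)) fun t => ?_
  have hsum := hasSum_integral_of_dominated_convergence (μ := gaussM)
    (F := fun (n : ℕ) (x : ℝ) => (t * x * Complex.I) ^ n / (n.factorial : ℂ) * (f x : ℂ))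
    (f := fun x => Complex.exp (t * x * Complex.I) * (f x : ℂ))
    (fun n x => |t * x| ^ n / n.factorial * |f x|)
    (fun n => by fun_prop)
    (fun n => Eventually.of_forall fun x => by simp [abs_mul])
    (Eventually.of_forall fun x =>
      ((Real.summable_pow_div_factorial _).mul_right _))
    ?_ (Eventually.of_forall fun x => ?_)
  · refine hsum.unique ?_
    convert hasSum_zero with n
    have hreal := integral_eval_mul_eq_zero hf h (X ^ n)
    have : ∀ x : ℝ, (t * x * Complex.I) ^ n / (n.factorial : ℂ) * (f x : ℂ) =
        ((t * Complex.I) ^ n / (n.factorial : ℂ)) * (((X ^ n : ℝ[X]).eval x * f x : ℝ) : ℂ) := by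
      intro x
      rw [eval_pow, eval_X]
      push_cast
      ring
    simp only [this]
    rw [integral_const_mul, integral_complex_ofReal, hreal]
    simp
  · have : ∀ x, ∑' n : ℕ, |t * x| ^ n / n.factorial * |f x| = Real.exp |t * x| * |f x| := by
      intro x
      rw [tsum_mul_right, Real.exp_eq_exp_ℝ, NormedSpace.exp_eq_tsum_div]
    simp only [this]
    exact (memLp_exp_abs t).integrable_mul hf.abs
  · refine HasSum.mul_right _ ?_
    rw [Complex.exp_eq_exp_ℂ]
    exact NormedSpace.expSeries_div_hasSum_exp _

/-- The square `√π 2^k k!` of the norm of `H_k`. -/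
def normSq (k : ℕ) : ℝ := Real.sqrt Real.pi * (2 ^ k * (Nat.factorial k : ℝ))

theorem normSq_pos (k : ℕ) : 0 < normSq k := by
  have := Real.pi_pos
  unfold normSq
  positivity

theorem inner_toLp {f g : ℝ → ℝ} (hf : MemLp f 2 gaussM) (hg : MemLp g 2 gaussM) :
    inner ℝ (hf.toLp f) (hg.toLp g) = ∫ x, f x * g x ∂gaussM := by
  rw [L2.inner_def]
  refine integral_congr_ae ?_
  filter_upwards [hf.coeFn_toLp, hg.coeFn_toLp] with x h1 h2
  rw [h1, h2]
  simp [mul_comm]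

/-- The normalized Hermite polynomial as an element of `L²(e^{-x²} dx)`. -/
def hermiteL2 (k : ℕ) : Lp ℝ 2 gaussM :=
  (Real.sqrt (normSq k))⁻¹ • (memLp_eval (H k)).toLp _

theorem orthonormal_hermiteL2 : Orthonormal ℝ hermiteL2 := by
  rw [orthonormal_iff_ite]
  intro i j
  rw [hermiteL2, hermiteL2, inner_smul_left, inner_smul_right, inner_toLp, integral_gaussM]
  have := integral_H_mul_H i j
  simp only [eval_mul] at this
  rw [this]
  by_cases hij : i = j
  · subst hij
    have h0 := Real.sqrt_pos.2 (normSq_pos i)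
    simp only [if_true]
    change (Real.sqrt (normSq i))⁻¹ * ((Real.sqrt (normSq i))⁻¹ * normSq i) = 1
    nth_rewrite 3 [← Real.mul_self_sqrt (normSq_pos i).le]
    field_simp
  · simp [hij]

theorem span_hermiteL2_orthogonal : (Submodule.span ℝ (Set.range hermiteL2))ᗮ = ⊥ := by
  rw [Submodule.eq_bot_iff]
  intro f hf
  rw [Submodule.mem_orthogonal] at hf
  rw [Lp.eq_zero_iff_ae_eq_zero]
  have hmem := Lp.memLp f
  refine ae_eq_zero_of_integral_H_mul (Lp.stronglyMeasurable f).measurable hmem fun k => ?_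
  have h := hf _ (Submodule.subset_span ⟨k, rfl⟩)
  rw [hermiteL2, inner_smul_left, ← Lp.toLp_coeFn f hmem, inner_toLp] at h
  refine (mul_eq_zero.1 h).resolve_left ?_
  have := Real.sqrt_pos.2 (normSq_pos k)
  simp [this.ne']

/-- Parseval's identity for the Hermite polynomials. -/
theorem hasSum_parseval {f g : ℝ → ℝ} (hf : MemLp f 2 gaussM) (hg : MemLp g 2 gaussM) :
    HasSum (fun k => (∫ x, f x * (H k).eval x ∂gaussM) * (∫ x, g x * (H k).eval x ∂gaussM) /
      normSq k) (∫ x, f x * g x ∂gaussM) := by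
  have h := (HilbertBasis.mkOfOrthogonalEqBot orthonormal_hermiteL2
    span_hermiteL2_orthogonal).hasSum_inner_mul_inner (hf.toLp f) (hg.toLp g)
  rw [inner_toLp] at h
  refine (iff_of_eq (congrArg (HasSum · _) (funext fun k => ?_))).2 h
  rw [HilbertBasis.coe_mkOfOrthogonalEqBot, hermiteL2, inner_smul_left, inner_smul_right,
    inner_toLp, inner_toLp]
  simp only [mul_comm ((H k).eval _), RCLike.conj_to_real]
  nth_rewrite 1 [← Real.mul_self_sqrt (normSq_pos k).le]
  ring

/-! ### Wronskians without real zeros -/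

/-- The operator `A f = x f' - f'' / 2`, for which `A H_k = k H_k`. -/
def numberOp : Module.End ℝ ℝ[X] :=
  LinearMap.mulLeft ℝ X ∘ₗ derivative - (1 / 2 : ℝ) • (derivative ∘ₗ derivative)

theorem numberOp_apply (f : ℝ[X]) :
    numberOp f = X * derivative f - C (1 / 2) * derivative (derivative f) := by
  simp [numberOp, smul_eq_C_mul]

theorem C_half_mul_two : C (1 / 2 : ℝ) * 2 = 1 := by
  rw [show (2 : ℝ[X]) = C 2 from (map_ofNat C 2).symm, ← C_mul]; simp

theorem numberOp_H (k : ℕ) : numberOp (H k) = (k : ℝ) • H k := by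
  rw [numberOp_apply, smul_eq_C_mul, map_natCast]
  linear_combination (-C (1 / 2 : ℝ)) * derivative_derivative_H k +
    (k * H k - X * derivative (H k)) * C_half_mul_two

theorem aeval_numberOp_H (P : ℝ[X]) (k : ℕ) :
    aeval numberOp P (H k) = P.eval (k : ℝ) • H k :=
  Module.End.aeval_apply_of_hasEigenvector
    (Module.End.hasEigenvector_iff.2 ⟨Module.End.mem_eigenspace_iff.2 (numberOp_H k), H_ne_zero k⟩)

/-- The bilinear form `∫_{x₀}^∞ f g e^{-x²} dx` on polynomials. -/
def halfInner (x₀ : ℝ) (f g : ℝ[X]) : ℝ :=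
  ∫ x in Set.Ioi x₀, (f * g).eval x * Real.exp (-x ^ 2)

theorem halfInner_add_right (x₀ : ℝ) (f g₁ g₂ : ℝ[X]) :
    halfInner x₀ f (g₁ + g₂) = halfInner x₀ f g₁ + halfInner x₀ f g₂ := by
  rw [halfInner, halfInner, halfInner, ← integral_add (integrable_eval_mul_gauss _).integrableOn
    (integrable_eval_mul_gauss _).integrableOn]
  simp [mul_add, add_mul]

theorem halfInner_smul_right (x₀ : ℝ) (f g : ℝ[X]) (c : ℝ) :
    halfInner x₀ f (c • g) = c * halfInner x₀ f g := by
  rw [halfInner, halfInner, ← integral_const_mul]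
  simp [mul_assoc]

theorem halfInner_comm (x₀ : ℝ) (f g : ℝ[X]) : halfInner x₀ f g = halfInner x₀ g f := by
  rw [halfInner, halfInner, mul_comm]

theorem integral_Ioi_deriv_mul_gauss (x₀ : ℝ) (p : ℝ[X]) :
    ∫ x in Set.Ioi x₀, (derivative p - 2 * X * p).eval x * Real.exp (-x ^ 2) =
      -(p.eval x₀ * Real.exp (-x₀ ^ 2)) := by
  have h := integral_Ioi_of_hasDerivAt_of_tendsto' (a := x₀) (m := 0)
    (f := fun x => p.eval x * Real.exp (-x ^ 2))
    (f' := fun x => (derivative p - 2 * X * p).eval x * Real.exp (-x ^ 2))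
    (fun x _ => by
      refine ((p.hasDerivAt x).mul (hasDerivAt_gauss x)).congr_deriv ?_
      simp only [eval_sub, eval_mul, eval_X, eval_ofNat]
      ring)
    (integrable_eval_mul_gauss _).integrableOn
    ((tendsto_eval_mul_gauss p).mono_left atTop_le_cocompact)
  rw [h, zero_sub]

/-- The boundary terms at `x₀` vanish if `f` has a double zero there. -/
theorem halfInner_numberOp {x₀ : ℝ} {f : ℝ[X]} (hf : (X - C x₀) ^ 2 ∣ f) (g : ℝ[X]) :
    halfInner x₀ (numberOp f) g = halfInner x₀ f (numberOp g) := by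
  have h0 : f.eval x₀ = 0 := by
    obtain ⟨q, rfl⟩ := hf; simp
  have h1 : (derivative f).eval x₀ = 0 := by
    obtain ⟨q, rfl⟩ := hf; simp [derivative_pow]
  have h := integral_Ioi_deriv_mul_gauss x₀
    (C (1 / 2) * (f * derivative g - derivative f * g))
  have hev : (C (1 / 2) * (f * derivative g - derivative f * g)).eval x₀ = 0 := by
    simp [h0, h1]
  rw [hev, zero_mul, neg_zero] at h
  rw [halfInner, halfInner, ← sub_eq_zero, ← integral_sub
    (integrable_eval_mul_gauss _).integrableOn (integrable_eval_mul_gauss _).integrableOn, ← h]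
  congr 1
  funext x
  rw [numberOp_apply, numberOp_apply, ← sub_mul, ← eval_sub]
  congr 2
  simp only [derivative_mul, derivative_sub, derivative_C]
  linear_combination (X * (f * derivative g - derivative f * g)) * C_half_mul_two

/-- The polynomial `∏_{s < r} (X - b s)`. -/
def prodSub (b : ℕ → ℕ) (r : ℕ) : ℝ[X] := ∏ s ∈ Finset.range r, (X - C (b s : ℝ))

theorem aeval_numberOp_X_sub_C (c : ℝ) (f : ℝ[X]) :
    aeval numberOp (X - C c) f = numberOp f - c • f := by
  simp [Module.algebraMap_end_apply]

theorem aeval_prodSub_succ (b : ℕ → ℕ) (r : ℕ) (f : ℝ[X]) :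
    aeval numberOp (prodSub b (r + 1)) f =
      numberOp (aeval numberOp (prodSub b r) f) - (b r : ℝ) • aeval numberOp (prodSub b r) f := by
  rw [prodSub, Finset.prod_range_succ, mul_comm, map_mul, Module.End.mul_apply,
    aeval_numberOp_X_sub_C]
  rfl

theorem aeval_prodSub_succ' (b : ℕ → ℕ) (r : ℕ) (f : ℝ[X]) :
    aeval numberOp (prodSub b (r + 1)) f =
      aeval numberOp (prodSub b r) (numberOp f - (b r : ℝ) • f) := by
  rw [prodSub, Finset.prod_range_succ, map_mul, Module.End.mul_apply,
    aeval_numberOp_X_sub_C]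
  rfl

theorem dvd_numberOp {x₀ : ℝ} {n : ℕ} {f : ℝ[X]} (hf : (X - C x₀) ^ (n + 2) ∣ f) :
    (X - C x₀) ^ n ∣ numberOp f := by
  have h1 := pow_sub_one_dvd_derivative_of_pow_dvd hf
  have h2 := pow_sub_one_dvd_derivative_of_pow_dvd h1
  rw [numberOp_apply]
  exact dvd_sub ((dvd_trans (pow_dvd_pow _ (by omega)) h1).mul_left _) (h2.mul_left _)

theorem dvd_aeval_prodSub (b : ℕ → ℕ) {x₀ : ℝ} {r n : ℕ} {f : ℝ[X]}
    (hf : (X - C x₀) ^ (n + 2 * r) ∣ f) :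
    (X - C x₀) ^ n ∣ aeval numberOp (prodSub b r) f := by
  induction r generalizing n with
  | zero => simpa [prodSub] using hf
  | succ r ih =>
    have h := ih (n := n + 2) (by rwa [show n + 2 + 2 * r = n + 2 * (r + 1) by ring])
    rw [aeval_prodSub_succ, smul_eq_C_mul]
    exact dvd_sub (dvd_numberOp h) ((dvd_trans (pow_dvd_pow _ (by omega)) h).mul_left _)

theorem halfInner_aeval_prodSub (b : ℕ → ℕ) {x₀ : ℝ} {r : ℕ} {f : ℝ[X]}
    (hf : (X - C x₀) ^ (2 * r) ∣ f) (g : ℝ[X]) :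
    halfInner x₀ (aeval numberOp (prodSub b r) f) g =
      halfInner x₀ f (aeval numberOp (prodSub b r) g) := by
  induction r generalizing g with
  | zero => simp [prodSub]
  | succ r ih =>
    have hf' : (X - C x₀) ^ (2 + 2 * r) ∣ f := by
      rwa [show 2 + 2 * r = 2 * (r + 1) by ring]
    have h2 := dvd_aeval_prodSub b (n := 2) hf'
    have ih' := ih (dvd_trans (pow_dvd_pow _ (by omega)) hf)
    rw [aeval_prodSub_succ, aeval_prodSub_succ', ← ih', sub_eq_add_neg, sub_eq_add_neg,
      ← neg_smul, ← neg_smul, halfInner_comm, halfInner_add_right, halfInner_smul_right,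
      halfInner_add_right, halfInner_smul_right, halfInner_comm x₀ g, halfInner_comm x₀ g,
      halfInner_numberOp h2]

/-- The polynomial `f` cut off to the half-line `(x₀, ∞)`. -/
def cutOff (x₀ : ℝ) (f : ℝ[X]) : ℝ → ℝ := (Set.Ioi x₀).indicator fun x => f.eval x

theorem memLp_cutOff (x₀ : ℝ) (f : ℝ[X]) : MemLp (cutOff x₀ f) 2 gaussM :=
  (memLp_eval f).indicator measurableSet_Ioi

theorem integral_cutOff_mul_eval (x₀ : ℝ) (f g : ℝ[X]) :
    ∫ x, cutOff x₀ f x * g.eval x ∂gaussM = halfInner x₀ f g := by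
  rw [integral_gaussM, halfInner, ← integral_indicator measurableSet_Ioi]
  congr 1
  funext x
  by_cases hx : x ∈ Set.Ioi x₀ <;> simp [cutOff, hx]

theorem integral_cutOff_mul_cutOff (x₀ : ℝ) (f g : ℝ[X]) :
    ∫ x, cutOff x₀ f x * cutOff x₀ g x ∂gaussM = halfInner x₀ f g := by
  rw [integral_gaussM, halfInner, ← integral_indicator measurableSet_Ioi]
  congr 1
  funext x
  by_cases hx : x ∈ Set.Ioi x₀ <;> simp [cutOff, hx]

theorem eq_zero_of_ae_eval_eq_zero {p : ℝ[X]} {S : Set ℝ} (hS : volume S ≠ 0)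
    (h : ∀ᵐ x : ℝ, x ∈ S → p.eval x = 0) : p = 0 := by
  by_contra hp
  have hfin : volume {x : ℝ | p.IsRoot x} = 0 := (finite_setOfPred_isRoot hp).measure_zero _
  refine hS (measure_mono_null (t := {x | p.IsRoot x} ∪ {x | ¬(x ∈ S → p.eval x = 0)}) ?_
    (measure_union_null hfin h))
  intro x hx
  by_cases h0 : p.eval x = 0
  · exact Or.inl h0
  · exact Or.inr fun h1 => h0 (h1 hx)

theorem sum_smul_H_ne_zero {n : ℕ} {a : ℕ → ℕ} (ha : Function.Injective a) {v : Fin n → ℝ}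
    (hv : v ≠ 0) : ∑ j, v j • H (a j) ≠ 0 := by
  intro h0
  refine hv (funext fun i => ?_)
  have h1 : ∫ x : ℝ, (H (a i) * ∑ j, v j • H (a j)).eval x * Real.exp (-x ^ 2) =
      v i * normSq (a i) := by
    have : ∀ x : ℝ, (H (a i) * ∑ j, v j • H (a j)).eval x * Real.exp (-x ^ 2) =
        ∑ j, v j * ((H (a i) * H (a j)).eval x * Real.exp (-x ^ 2)) := fun x => by
      simp only [eval_mul, eval_finsetSum, eval_smul, Finset.mul_sum, Finset.sum_mul, smul_eq_mul]
      exact Finset.sum_congr rfl fun j _ => by ring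
    simp only [this]
    rw [integral_finsetSum _ fun j _ => (integrable_eval_mul_gauss _).const_mul _]
    simp only [integral_const_mul, integral_H_mul_H]
    rw [Finset.sum_eq_single i]
    · simp [normSq]
    · intro j _ hj
      rw [if_neg fun h => hj (Fin.ext (ha h)).symm, mul_zero]
    · simp
  rw [h0] at h1
  simp only [mul_zero, eval_zero, zero_mul, integral_zero] at h1
  exact (mul_eq_zero.1 h1.symm).resolve_right (normSq_pos _).ne'

/-- Let `M` be a set of `2r` numbers that is a union of pairs
`{b, b + 1}`, and let `p` be a linear combination of `H_m`, `m ∈ M`, that vanishes to order `2r`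
at `x₀`. The function `u = p 1_{x > x₀}` is so smooth at `x₀` that the quadratic form of
`∏ (A - b)(A - b - 1)` at `u` may be computed by partial integration; it is zero, since this
operator annihilates `p`. In terms of Hermite coefficients the form is
`∑_k ∏ (k - b)(k - b - 1) |⟨u, H_k⟩|² / ‖H_k‖²` with non-negative terms, so all Hermite coefficients
of `u` outside `M` vanish, and `u` would be a polynomial. In the formal statement `M` is listed as
`a 0, …, a (2r - 1)`, and the pairs start at `b 0, …, b (r - 1)`. -/
theorem wr_eval_ne_zero {a b : ℕ → ℕ} (ha : Function.Injective a) {n r : ℕ} (hn : n = 2 * r)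
    (hab : ∀ k, (∃ j < 2 * r, a j = k) ↔ ∃ s < r, k = b s ∨ k = b s + 1) (x₀ : ℝ) :
    (wr fun j : Fin n => H (a j)).eval x₀ ≠ 0 := by
  subst hn
  intro hW
  -- the combination `p` that vanishes to order `2r` at `x₀`
  have hdet : ((Matrix.of fun i j : Fin (2 * r) => derivative^[(i : ℕ)] (H (a j))).map
      (eval x₀)).det = 0 := by
    have := RingHom.map_det (evalRingHom x₀)
      (Matrix.of fun i j : Fin (2 * r) => derivative^[(i : ℕ)] (H (a j)))
    rw [← hW]
    exact this.symm
  obtain ⟨v, hv, hMv⟩ := Matrix.exists_mulVec_eq_zero_iff.2 hdet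
  set p : ℝ[X] := ∑ j, v j • H (a j) with hp
  have hp0 : p ≠ 0 := sum_smul_H_ne_zero ha hv
  have hder : ∀ i < 2 * r, (derivative^[i] p).IsRoot x₀ := fun i hi => by
    have := congrFun hMv ⟨i, hi⟩
    simp only [Matrix.mulVec, dotProduct, Matrix.map_apply, Matrix.of_apply, Pi.zero_apply] at this
    rw [IsRoot, hp, iterate_derivative_sum, eval_finsetSum, ← this]
    refine Finset.sum_congr rfl fun j _ => ?_
    rw [iterate_derivative_smul, eval_smul, smul_eq_mul, mul_comm]
  have hdvd : (X - C x₀) ^ (2 * r) ∣ p := by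
    rw [← le_rootMultiplicity_iff hp0]
    rcases Nat.eq_zero_or_pos (2 * r) with h0 | h0
    · omega
    · have := (lt_rootMultiplicity_iff_isRoot_iterate_derivative hp0 (t := x₀)
        (n := 2 * r - 1)).2 fun m hm => hder m (by omega)
      omega
  -- the two factors of the quadratic form
  set P₁ := prodSub b r with hP₁
  set P₂ := prodSub (fun s => b s + 1) r with hP₂
  have hev₁ : ∀ k : ℕ, P₁.eval (k : ℝ) = ∏ s ∈ Finset.range r, ((k : ℝ) - b s) := fun k => by
    simp [hP₁, prodSub, eval_prod]
  have hev₂ : ∀ k : ℕ, P₂.eval (k : ℝ) = ∏ s ∈ Finset.range r, ((k : ℝ) - (b s + 1)) := fun k => by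
    simp [hP₂, prodSub, eval_prod]
  have hnonneg : ∀ k : ℕ, 0 ≤ P₁.eval (k : ℝ) * P₂.eval (k : ℝ) := fun k => by
    rw [hev₁, hev₂, ← Finset.prod_mul_distrib]
    refine Finset.prod_nonneg fun s _ => ?_
    rcases le_or_gt k (b s) with h | h
    · have : (k : ℝ) ≤ b s := by exact_mod_cast h
      nlinarith
    · have : (b s : ℝ) + 1 ≤ k := by exact_mod_cast h
      nlinarith
  have hzero : ∀ k : ℕ, P₁.eval (k : ℝ) * P₂.eval (k : ℝ) = 0 ↔ ∃ j < 2 * r, a j = k := fun k => by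
    rw [hab, hev₁, hev₂, mul_eq_zero, Finset.prod_eq_zero_iff, Finset.prod_eq_zero_iff]
    simp only [Finset.mem_range, sub_eq_zero]
    norm_cast
    constructor
    · rintro (⟨s, hs, h⟩ | ⟨s, hs, h⟩)
      · exact ⟨s, hs, Or.inl h⟩
      · exact ⟨s, hs, Or.inr h⟩
    · rintro ⟨s, hs, h | h⟩
      · exact Or.inl ⟨s, hs, h⟩
      · exact Or.inr ⟨s, hs, h⟩
  have hann : aeval numberOp P₁ (aeval numberOp P₂ p) = 0 := by
    rw [hp, map_sum, map_sum]
    refine Finset.sum_eq_zero fun j _ => ?_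
    rw [map_smul, map_smul, aeval_numberOp_H, map_smul, aeval_numberOp_H, smul_smul _ _ (H _),
      mul_comm (P₂.eval _), (hzero _).2 ⟨j, j.2, rfl⟩, zero_smul, smul_zero]
  have hform : halfInner x₀ (aeval numberOp P₁ p) (aeval numberOp P₂ p) = 0 := by
    rw [halfInner_aeval_prodSub b hdvd, hann]
    simp [halfInner]
  have hpars := hasSum_parseval (memLp_cutOff x₀ (aeval numberOp P₁ p))
    (memLp_cutOff x₀ (aeval numberOp P₂ p))
  simp only [integral_cutOff_mul_cutOff, integral_cutOff_mul_eval, hform] at hpars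
  have hterm : ∀ k, halfInner x₀ (aeval numberOp P₁ p) (H k) *
      halfInner x₀ (aeval numberOp P₂ p) (H k) / normSq k =
      P₁.eval (k : ℝ) * P₂.eval (k : ℝ) * (halfInner x₀ p (H k) ^ 2 / normSq k) := fun k => by
    rw [halfInner_aeval_prodSub b hdvd, halfInner_aeval_prodSub _ hdvd, aeval_numberOp_H,
      aeval_numberOp_H, halfInner_smul_right, halfInner_smul_right]
    ring
  simp only [hterm] at hpars
  rw [hasSum_zero_iff_of_nonneg fun k => mul_nonneg (hnonneg k)
    (div_nonneg (sq_nonneg _) (normSq_pos k).le)] at hpars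
  have hcoef : ∀ k, (¬∃ j < 2 * r, a j = k) → halfInner x₀ p (H k) = 0 := fun k hk => by
    have h1 := (mul_eq_zero.1 (congrFun hpars k)).resolve_left fun h => hk ((hzero k).1 h)
    rcases div_eq_zero_iff.1 h1 with h2 | h2
    · exact pow_eq_zero_iff two_ne_zero |>.1 h2
    · exact absurd h2 (normSq_pos k).ne'
  -- the polynomial with the same Hermite coefficients as the cut-off of `p`
  set q : ℝ[X] := ∑ j : Fin (2 * r), (halfInner x₀ p (H (a j)) / normSq (a j)) • H (a j) with hq
  have hqcoef : ∀ k, ∫ x, (H k).eval x * q.eval x ∂gaussM = halfInner x₀ p (H k) := fun k => by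
    rw [integral_gaussM]
    have : ∀ x : ℝ, (H k).eval x * q.eval x * Real.exp (-x ^ 2) =
        ∑ j : Fin (2 * r), halfInner x₀ p (H (a j)) / normSq (a j) *
          ((H k * H (a j)).eval x * Real.exp (-x ^ 2)) := fun x => by
      simp only [hq, eval_mul, eval_finsetSum, eval_smul, Finset.mul_sum, Finset.sum_mul,
        smul_eq_mul]
      exact Finset.sum_congr rfl fun j _ => by ring
    simp only [this]
    rw [integral_finsetSum _ fun j _ => (integrable_eval_mul_gauss _).const_mul _]
    simp only [integral_const_mul, integral_H_mul_H]
    by_cases hk : ∃ j < 2 * r, a j = k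
    · obtain ⟨j, hj, rfl⟩ := hk
      rw [Finset.sum_eq_single (⟨j, hj⟩ : Fin (2 * r))]
      · simp only [if_true]
        exact div_mul_cancel₀ _ (normSq_pos _).ne'
      · intro i _ hi
        rw [if_neg fun h => hi (Fin.ext (ha h).symm), mul_zero]
      · simp
    · rw [hcoef k hk]
      refine Finset.sum_eq_zero fun j _ => ?_
      rw [if_neg fun h => hk ⟨j, j.2, h.symm⟩, mul_zero]
  have hmem : MemLp (fun x => cutOff x₀ p x - q.eval x) 2 gaussM :=
    (memLp_cutOff x₀ p).sub (memLp_eval q)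
  have hae : ∀ᵐ x : ℝ, cutOff x₀ p x - q.eval x = 0 := by
    refine ae_gaussM_iff.1 (ae_eq_zero_of_integral_H_mul ?_ hmem fun k => ?_)
    · exact (p.continuous.measurable.indicator measurableSet_Ioi).sub q.continuous.measurable
    · simp only [mul_sub]
      rw [integral_sub (integrable_eval_mul (memLp_cutOff x₀ p) _)
        (integrable_eval_mul (memLp_eval q) _), hqcoef]
      simp only [mul_comm ((H k).eval _)]
      rw [integral_cutOff_mul_eval, sub_self]
  have hq0 : q = 0 := by
    refine eq_zero_of_ae_eval_eq_zero (S := Set.Iio x₀) (by simp) ?_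
    filter_upwards [hae] with x hx hlt
    have : x ∉ Set.Ioi x₀ := not_lt.2 (le_of_lt (Set.mem_Iio.1 hlt))
    simpa [cutOff, this] using hx
  refine hp0 (eq_zero_of_ae_eval_eq_zero (S := Set.Ioi x₀) (by simp) ?_)
  filter_upwards [hae] with x hx hlt
  simpa [cutOff, hq0, Set.mem_Ioi.1 hlt] using hx

/-! ### Partitions -/

section Partition

variable {lam : ℕ →₀ ℕ}

theorem apply_eq_zero_of_length_le (hlam : IsPartition lam) {i : ℕ} (hi : length lam ≤ i) :
    lam i = 0 := by
  have hne : {l : ℕ | lam l = 0}.Nonempty := by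
    obtain ⟨l, hl⟩ := Infinite.exists_notMem_finset lam.support
    exact ⟨l, Finsupp.notMem_support_iff.1 hl⟩
  have h1 : lam (length lam) = 0 := Nat.sInf_mem hne
  have h2 := hlam hi
  omega

theorem apply_pos_of_lt_length {i : ℕ} (hi : i < length lam) : 0 < lam i :=
  Nat.pos_of_ne_zero fun h => Nat.notMem_of_lt_sInf (s := {l : ℕ | lam l = 0}) hi h

theorem length_le_size : length lam ≤ size lam := by
  have hsub : Finset.range (length lam) ⊆ lam.support := fun i hi =>
    Finsupp.mem_support_iff.2 (apply_pos_of_lt_length (Finset.mem_range.1 hi)).ne'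
  calc length lam = ∑ _i ∈ Finset.range (length lam), 1 := by simp
    _ ≤ ∑ i ∈ Finset.range (length lam), lam i :=
      Finset.sum_le_sum fun i hi => apply_pos_of_lt_length (Finset.mem_range.1 hi)
    _ ≤ size lam := Finset.sum_le_sum_of_subset hsub

/-- The increasing list of the numbers `m_ℓ < ⋯ < m_1`. From the index `ℓ` on, the truncated
subtraction gives the values `λ_1 + j`, so the sequence is increasing throughout. -/
def mSeq (lam : ℕ →₀ ℕ) (j : ℕ) : ℕ := lam (length lam - 1 - j) + j

theorem mSeq_injective (hlam : IsPartition lam) : Function.Injective (mSeq lam) := by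
  refine StrictMono.injective (strictMono_nat_of_lt_succ fun j => ?_)
  have : lam (length lam - 1 - j) ≤ lam (length lam - 1 - (j + 1)) := hlam (by omega)
  unfold mSeq
  omega

theorem hermiteList_eq (lam : ℕ →₀ ℕ) :
    hermiteList lam = fun j : Fin (length lam) => H (mSeq lam j) := by
  funext j
  have hj := j.2
  simp only [hermiteList, m, mSeq, Fin.val_rev]
  congr 2
  · congr 1; omega
  · omega

theorem exists_length_eq_two_mul (hlam : IsPartition lam) (heven : IsEven lam) :
    ∃ r, length lam = 2 * r := by
  rcases Nat.even_or_odd' (length lam) with ⟨r, h | h⟩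
  · exact ⟨r, h⟩
  · have h1 := apply_pos_of_lt_length (lam := lam) (i := 2 * r) (by omega)
    have h2 := apply_eq_zero_of_length_le hlam (i := 2 * r + 1) (by omega)
    have h3 := heven r
    omega

/-- The two parts `λ_{2i-1} = λ_{2i}` give a pair of consecutive numbers `m_{2i}`,
`m_{2i-1} = m_{2i} + 1`. -/
theorem wr_hermiteList_eval_ne_zero (hlam : IsPartition lam) (heven : IsEven lam) (x : ℝ) :
    (wr (hermiteList lam)).eval x ≠ 0 := by
  obtain ⟨r, hr⟩ := exists_length_eq_two_mul hlam heven
  have hpair : ∀ s < r, mSeq lam (2 * s + 1) = mSeq lam (2 * s) + 1 := fun s hs => by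
    have h := heven (r - 1 - s)
    unfold mSeq
    rw [show length lam - 1 - (2 * s + 1) = 2 * (r - 1 - s) by omega,
      show length lam - 1 - 2 * s = 2 * (r - 1 - s) + 1 by omega, h]
    omega
  rw [hermiteList_eq]
  refine wr_eval_ne_zero (b := fun s => mSeq lam (2 * s)) (mSeq_injective hlam) hr
    (fun k => ⟨?_, ?_⟩) x
  · rintro ⟨j, hj, rfl⟩
    rcases Nat.even_or_odd' j with ⟨s, rfl | rfl⟩
    · exact ⟨s, by omega, Or.inl rfl⟩
    · exact ⟨s, by omega, Or.inr (hpair s (by omega))⟩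
  · rintro ⟨s, hs, rfl | rfl⟩
    · exact ⟨2 * s, by omega, rfl⟩
    · exact ⟨2 * s + 1, by omega, hpair s hs⟩

theorem constC_ne_zero (hlam : IsPartition lam) (l : ℕ) : constC lam l ≠ 0 := by
  refine mul_ne_zero (by positivity) (Finset.prod_ne_zero_iff.2 fun j _ =>
    Finset.prod_ne_zero_iff.2 fun i hi => ?_)
  have hij := Finset.mem_range.1 hi
  have h1 : (lam j : ℝ) ≤ lam i := by exact_mod_cast hlam hij.le
  have h2 : (i : ℝ) < j := by exact_mod_cast hij
  linarith

/-- The factors of `π^λ_ℓ(n)` are the differences `(n - N + ℓ) - m_i`. -/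
theorem prod_sub_mSeq {n : ℕ} (hn : size lam ≤ n + length lam) :
    ∏ j ∈ Finset.range (length lam), (2 * (((n + length lam - size lam : ℕ) : ℝ) - mSeq lam j)) =
      2 ^ length lam * (piLam lam (length lam) n : ℝ) := by
  rw [Finset.prod_mul_distrib, Finset.prod_const, Finset.card_range, piLam,
    ← Finset.prod_range_reflect]
  push_cast [Nat.cast_sub hn]
  congr 1
  refine Finset.prod_congr rfl fun j hj => ?_
  have hj' := Finset.mem_range.1 hj
  have : (mSeq lam (length lam - 1 - j) : ℝ) = lam j + (length lam - 1 - j) := by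
    rw [mSeq, show length lam - 1 - (length lam - 1 - j) = j by omega, Nat.cast_add,
      Nat.cast_sub (by omega), Nat.cast_sub (by omega), Nat.cast_one]
  rw [this]
  ring

/-- The factors of `π^λ_N(n)` that belong to the zero parts of `λ` have the product
`n! / (n - N + ℓ)!`. -/
theorem piLam_size_mul_factorial (hlam : IsPartition lam) {n : ℕ}
    (hn : size lam ≤ n + length lam) :
    piLam lam (size lam) n * ((n + length lam - size lam).factorial : ℤ) =
      piLam lam (length lam) n * (n.factorial : ℤ) := by
  obtain ⟨d, hd⟩ := Nat.exists_eq_add_of_le (length_le_size (lam := lam))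
  obtain ⟨k, hk⟩ := Nat.exists_eq_add_of_le hn
  have hn' : n = k + d := by omega
  have h1 : piLam lam (size lam) n =
      piLam lam (length lam) n * ∏ i ∈ Finset.range d, ((k : ℤ) + 1 + i) := by
    unfold piLam
    rw [hd, Finset.prod_range_add]
    congr 1
    refine Finset.prod_congr rfl fun i _ => ?_
    rw [apply_eq_zero_of_length_le hlam (Nat.le_add_right _ _)]
    rw [hn']
    push_cast
    ring
  have h2 : (n.factorial : ℤ) = (k.factorial : ℤ) * ∏ i ∈ Finset.range d, ((k : ℤ) + 1 + i) := by
    rw [hn', ← Nat.factorial_mul_ascFactorial, Nat.ascFactorial_eq_prod_range]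
    push_cast
    ring
  rw [h1, h2, show n + length lam - size lam = k by omega]
  ring

/-- The integrand of the inner product in terms of Wronskians. -/
theorem excH_mul_excH_mul_weight (hlam : IsPartition lam) (n n' : ℕ) (x : ℝ) :
    (excH lam n).eval x * (excH lam n').eval x * weight lam x =
      ((2 ^ length lam * (piLam lam (length lam) n : ℝ))⁻¹ *
        (2 ^ length lam * (piLam lam (length lam) n' : ℝ))⁻¹) *
      ((wr (Fin.snoc (α := fun _ => ℝ[X]) (fun j : Fin (length lam) => H (mSeq lam j))
          (H (n + length lam - size lam))) *
        wr (Fin.snoc (α := fun _ => ℝ[X]) (fun j : Fin (length lam) => H (mSeq lam j))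
          (H (n' + length lam - size lam)))).eval x /
        ((wr fun j : Fin (length lam) => H (mSeq lam j)) ^ 2).eval x * Real.exp (-x ^ 2)) := by
  have hC := constC_ne_zero hlam (length lam)
  rw [excH, excH, weight, eta, hermiteList_eq]
  simp only [eval_mul, eval_C, eval_pow, mul_inv, mul_pow, inv_pow, inv_inv, div_eq_mul_inv]
  set c := constC lam (length lam)
  have : c⁻¹ * c⁻¹ * c ^ 2 = 1 := by field_simp
  linear_combination ((2 ^ length lam)⁻¹ * (piLam lam (length lam) n : ℝ)⁻¹ *
    ((2 ^ length lam)⁻¹ * (piLam lam (length lam) n' : ℝ)⁻¹) *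
    ((wr (Fin.snoc (α := fun _ => ℝ[X]) (fun j : Fin (length lam) => H (mSeq lam j))
          (H (n + length lam - size lam)))).eval x *
        (wr (Fin.snoc (α := fun _ => ℝ[X]) (fun j : Fin (length lam) => H (mSeq lam j))
          (H (n' + length lam - size lam)))).eval x *
        ((wr fun j : Fin (length lam) => H (mSeq lam j)).eval x ^ 2)⁻¹ *
        Real.exp (-x ^ 2))) * this

end Partition

end ExcHermite

end

theorem mainTheorem4 (lam : ℕ →₀ ℕ) (hlam : ExcHermite.IsPartition lam)
    (heven : ExcHermite.IsEven lam) :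
    (∀ x : ℝ, (ExcHermite.eta lam).eval x ≠ 0) ∧
    ∀ n ∈ ExcHermite.degreeSet lam, ∀ n' ∈ ExcHermite.degreeSet lam,
      MeasureTheory.Integrable (fun x : ℝ =>
        (ExcHermite.excH lam n).eval x * (ExcHermite.excH lam n').eval x *
          ExcHermite.weight lam x) ∧
      ExcHermite.innerLam lam (ExcHermite.excH lam n) (ExcHermite.excH lam n') =
        Real.sqrt Real.pi * (2 : ℝ) ^ ((n : ℤ) - (ExcHermite.size lam : ℤ)) *
          ((Nat.factorial n : ℝ) / (ExcHermite.piLam lam (ExcHermite.size lam) n : ℝ)) *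
          (if n = n' then 1 else 0) := by
  have hW := ExcHermite.wr_hermiteList_eval_ne_zero hlam heven
  refine ⟨fun x => ?_, fun n hn n' hn' => ?_⟩
  · rw [ExcHermite.eta, eval_mul, eval_C]
    exact mul_ne_zero (inv_ne_zero (ExcHermite.constC_ne_zero hlam _)) (hW x)
  rw [ExcHermite.hermiteList_eq] at hW
  obtain ⟨h1, hπ⟩ := hn
  obtain ⟨h1', -⟩ := hn'
  have hle : ExcHermite.size lam ≤ n + ExcHermite.length lam := by omega
  have hle' : ExcHermite.size lam ≤ n' + ExcHermite.length lam := by omega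
  have hfun := funext (ExcHermite.excH_mul_excH_mul_weight hlam n n')
  constructor
  · rw [hfun]
    exact (ExcHermite.integrable_eval_div_mul_gauss _ fun x => by
      rw [eval_pow]; exact pow_ne_zero 2 (hW x)).const_mul _
  · rw [ExcHermite.innerLam, hfun, MeasureTheory.integral_const_mul,
      ExcHermite.integral_wr_mul_wr (ExcHermite.mSeq_injective hlam) _ _ _ hW,
      ExcHermite.prod_sub_mSeq hle']
    by_cases hnn : n = n'
    · subst hnn
      rw [if_pos rfl, if_pos rfl]
      have hfac := ExcHermite.piLam_size_mul_factorial hlam hle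
      have hπ' : (ExcHermite.piLam lam (ExcHermite.length lam) n : ℝ) ≠ 0 := by exact_mod_cast hπ
      have hfac' : (ExcHermite.piLam lam (ExcHermite.size lam) n : ℝ) *
          ((n + ExcHermite.length lam - ExcHermite.size lam).factorial : ℝ) =
          (ExcHermite.piLam lam (ExcHermite.length lam) n : ℝ) * (n.factorial : ℝ) := by
        exact_mod_cast hfac
      have hne : (ExcHermite.piLam lam (ExcHermite.size lam) n : ℝ) ≠ 0 := by
        intro h0
        rw [h0, zero_mul] at hfac'
        exact (mul_ne_zero hπ' (by positivity)) hfac'.symm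
      have hpow : (2 : ℝ) ^ ((n : ℤ) - (ExcHermite.size lam : ℤ)) * 2 ^ ExcHermite.length lam =
          2 ^ (n + ExcHermite.length lam - ExcHermite.size lam) := by
        rw [← zpow_natCast, ← zpow_natCast, ← zpow_add₀ two_ne_zero]
        congr 1
        omega
      rw [← hpow]
      field_simp
      linear_combination hfac'
    · rw [if_neg hnn, if_neg (by omega), mul_zero, mul_zero, mul_zero]
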